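/- **Theorem (Simple PI lower bounds).** For integers $n\ge 1$, $k\ge 2$ let $H(n,k)$ be the following Markov decision problem with action set $\{0,1,\dots,k-1\}$ and the (undiscounted) total reward criterion. It has states $s_1,\dots,s_n$, partner states $s'_1,\dots,s'_n$ and two absorbing, reward-free terminal states $t_-$ and $t_0$; entering $t_-$ from a non-terminal state gives reward $-1$, entering $t_0$ gives reward $0$. Put $s_0=s_{-1}=t_-$, $s'_0=t_0$ and $\varepsilon=2^{-n}$. At $s_i$, action $0$ moves to $s_{i-1}$ with action reward $0$, and each action $j\in\{1,\dots,k-1\}$ moves to $s'_i$ with action reward $\varepsilon/2^{k-1-j}$. From $s'_i$ every action moves to $s'_{i-1}$ or to $s_{i-2}$, with probability $1/2$ each and action reward $0$. For a policy $\pi$ (a map from states to actions) with value function $V^\pi$ and action values $Q^\pi$, an action $a$ is improving at a state $s$ if $Q^\pi(s,a)>Q^\pi(s,\pi(s))$, and $s$ is improvable if it has an improving action. Each iteration of Simple PI switches the action of the improvable state of largest index, for a fixed indexing of the states in which $s_1,\dots,s_n$ have increasing indices; the algorithm stops when there is no improvable state. With index-based action selection the new action is the smallest improving action; with random action selection it is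 drawn uniformly at random from the improving actions. There is an absolute constant $c>0$ such that for all $n\ge 1$ and $k\ge 2$, Simple PI on $H(n,k)$ started from the policy $0^n$ (action $0$ everywhere) takes at least $c\,k\,2^n$ iterations with index-based action selection, and at least $c\,\log(k)\,2^n$ iterations in expectation with random action selection. That is, it takes $\Omega(k\cdot 2^n)$ and $\Omega(\log(k)\cdot 2^n)$ iterations, respectively. -/

import Mathlib

open MeasureTheory ProbabilityTheory
open scoped ENNReal

/-- A finite Markov decision problem with state set `S`, action set `{0, …, k - 1}`, transition
function `T`, reward function `R` and discount factor `γ`. The case `γ = 1` is the total reward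
setting. A terminal state is a state that every action maps to itself with reward `0`. -/
structure MDP (S : Type) [Fintype S] (k : ℕ) where
  T : S → Fin k → S → ℝ
  R : S → Fin k → ℝ
  γ : ℝ
  T_nonneg : ∀ s a s', 0 ≤ T s a s'
  T_sum : ∀ s a, ∑ s', T s a s' = 1
  γ_nonneg : 0 ≤ γ
  γ_le_one : γ ≤ 1

namespace MDP

/-- Deterministic, stationary, Markovian policies. -/
abbrev Policy (S : Type) (k : ℕ) : Type := S → Fin k

variable {S : Type} [Fintype S] {k : ℕ}

/-- The expected reward `E_{π,s}[r_t]` obtained at time `t` when starting at `s` and following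
`π`. -/
def expReward (M : MDP S k) (π : Policy S k) : ℕ → S → ℝ
  | 0, s => M.R s (π s)
  | t + 1, s => ∑ s', M.T s (π s) s' * M.expReward π t s'

/-- The value function `V^π(s) = E_{π,s}[r_0 + γ r_1 + γ² r_2 + ⋯]`. -/
noncomputable def V (M : MDP S k) (π : Policy S k) (s : S) : ℝ :=
  ∑' t : ℕ, M.γ ^ t * M.expReward π t s

/-- The action value function `Q^π(s, a)`. -/
noncomputable def Q (M : MDP S k) (π : Policy S k) (s : S) (a : Fin k) : ℝ :=
  M.R s a + M.γ * ∑ s', M.T s a s' * M.V π s'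

/-- The set `IA(π, s)` of improving actions of `π` at `s`. -/
noncomputable def IA (M : MDP S k) (π : Policy S k) (s : S) : Finset (Fin k) :=
  Finset.univ.filter fun a => M.Q π s (π s) < M.Q π s a

/-- The set `IS(π)` of improvable states: those `s` with `Q^π(s, π(s)) < max_a Q^π(s, a)`. -/
noncomputable def IS (M : MDP S k) (π : Policy S k) : Finset S :=
  Finset.univ.filter fun s => ∃ a, M.Q π s (π s) < M.Q π s a

theorem IA_nonempty (M : MDP S k) (π : Policy S k) {s : S} (hs : s ∈ M.IS π) :
    (M.IA π s).Nonempty := by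
  obtain ⟨a, ha⟩ := (Finset.mem_filter.1 hs).2
  exact ⟨a, Finset.mem_filter.2 ⟨Finset.mem_univ a, ha⟩⟩

/-- The state switched by Simple PI, given an indexing `idx` of the states: the improvable state
with the largest index. -/
noncomputable def simpleState (M : MDP S k) (idx : S ↪ ℕ) (π : Policy S k)
    (h : (M.IS π).Nonempty) : S :=
  ((M.IS π).exists_max_image idx h).choose

theorem simpleState_mem (M : MDP S k) (idx : S ↪ ℕ) (π : Policy S k)
    (h : (M.IS π).Nonempty) : M.simpleState idx π h ∈ M.IS π :=
  ((M.IS π).exists_max_image idx h).choose_spec.1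

theorem le_simpleState (M : MDP S k) (idx : S ↪ ℕ) (π : Policy S k)
    (h : (M.IS π).Nonempty) : ∀ s ∈ M.IS π, idx s ≤ idx (M.simpleState idx π h) :=
  ((M.IS π).exists_max_image idx h).choose_spec.2

/-- The number of iterations taken along a sequence of policies: the number of switches made until
the first policy without improvable states is reached (`⊤` if there is none). -/
noncomputable def iterations (M : MDP S k) (x : ℕ → Policy S k) : ℕ∞ :=
  ⨅ (t : ℕ) (_ : M.IS (x t) = ∅), (t : ℕ∞)

variable [DecidableEq S]

/-- One iteration of Simple PI with index-based action selection: the selected state is switched to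
its improving action with the smallest index. A policy without improvable states is kept. -/
noncomputable def indexStep (M : MDP S k) (idx : S ↪ ℕ) (π : Policy S k) : Policy S k :=
  if h : (M.IS π).Nonempty then
    Function.update π (M.simpleState idx π h)
      ((M.IA π (M.simpleState idx π h)).min' (M.IA_nonempty π (M.simpleState_mem idx π h)))
  else π

/-- The number of iterations of Simple PI with index-based action selection, from policy `π₀`. -/
noncomputable def indexIterations (M : MDP S k) (idx : S ↪ ℕ) (π₀ : Policy S k) : ℕ∞ :=
  M.iterations fun t => (M.indexStep idx)^[t] π₀

/-- One iteration of Simple PI with random action selection: the selected state is switched to an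
action drawn uniformly at random from its improving actions. A policy without improvable states
is kept. -/
noncomputable def randomStep (M : MDP S k) (idx : S ↪ ℕ) (π : Policy S k) : PMF (Policy S k) :=
  if h : (M.IS π).Nonempty then
    (PMF.uniformOfFinset (M.IA π (M.simpleState idx π h))
      (M.IA_nonempty π (M.simpleState_mem idx π h))).map
        fun a => Function.update π (M.simpleState idx π h) a
  else PMF.pure π

/-- The conditional law of the policy at time `t + 1` given the policies at times `0, …, t`: it is
given by `randomStep` at the policy at time `t`. -/
noncomputable def randomKernel (M : MDP S k) (idx : S ↪ ℕ) (t : ℕ) :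
    Kernel ((_ : Finset.Iic t) → Policy S k) (Policy S k) where
  toFun x := (M.randomStep idx (x ⟨t, Finset.mem_Iic.2 le_rfl⟩)).toMeasure
  measurable' :=
    (Measurable.of_discrete (f := fun π => (M.randomStep idx π).toMeasure)).comp
      (measurable_pi_apply _)

instance (M : MDP S k) (idx : S ↪ ℕ) (t : ℕ) : IsMarkovKernel (M.randomKernel idx t) :=
  ⟨fun x => inferInstanceAs
    (IsProbabilityMeasure (M.randomStep idx (x ⟨t, Finset.mem_Iic.2 le_rfl⟩)).toMeasure)⟩

/-- The law of the random sequence of policies `π₀, π₁, …` visited by Simple PI with random action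
selection. -/
noncomputable def randomRun (M : MDP S k) (idx : S ↪ ℕ) (π₀ : Policy S k) :
    Measure (ℕ → Policy S k) :=
  Kernel.traj (X := fun _ => Policy S k) (M.randomKernel idx) 0 fun _ => π₀

/-- The expected number of iterations of Simple PI with random action selection. -/
noncomputable def randomExpectedIterations (M : MDP S k) (idx : S ↪ ℕ) (π₀ : Policy S k) : ℝ≥0∞ :=
  ∫⁻ x, (M.iterations x : ℝ≥0∞) ∂M.randomRun idx π₀

end MDP

/-- The states of `H(n, k)`. With `i` running through `0, …, n - 1`, `s i` is the state `s_{i+1}`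
and `p i` is its partner `s'_{i+1}`. There are two terminal states: `tNeg`, reached with reward
`-1`, and `tZero`, reached with reward `0`. -/
inductive HState (n : ℕ) : Type
  | s (i : Fin n)
  | p (i : Fin n)
  | tNeg
  | tZero
  deriving DecidableEq, Fintype

namespace HState

variable {n : ℕ}

/-- The state one step below `s i`, i.e. `s_{i-1}` in 1-based numbering, where `s_0 = tNeg`. -/
def prev (i : Fin n) : HState n :=
  if _h : i.val = 0 then tNeg else s ⟨i.val - 1, by omega⟩

/-- The state two steps below `s i`, i.e. `s_{i-2}` in 1-based numbering, where
`s_0 = s_{-1} = tNeg`. -/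
def prevPrev (i : Fin n) : HState n :=
  if _h : i.val ≤ 1 then tNeg else s ⟨i.val - 2, by omega⟩

/-- The partner state one step below `p i`, i.e. `s'_{i-1}` in 1-based numbering, where
`s'_0 = tZero`. -/
def prevPartner (i : Fin n) : HState n :=
  if _h : i.val = 0 then tZero else p ⟨i.val - 1, by omega⟩

/-- Action `0` moves from `s_i` to `s_{i-1}`, every other action moves from `s_i` to its partner
`s'_i`. From `s'_i` every action moves to `s'_{i-1}` or to `s_{i-2}`, with probability `1/2` each.
Terminal states are absorbing. -/
noncomputable def transProb {k : ℕ} : HState n → Fin k → HState n → ℝ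
  | s i, a, x => if x = (if a.val = 0 then prev i else p i) then 1 else 0
  | p i, _, x => (if x = prevPartner i then 1 / 2 else 0) + (if x = prevPrev i then 1 / 2 else 0)
  | tNeg, _, x => if x = tNeg then 1 else 0
  | tZero, _, x => if x = tZero then 1 else 0

/-- The reward for taking an action: `ε / 2^(k-1-j)` for action `j ≠ 0` at a state `s_i`, where
`ε = 2^(-n)`, and `0` otherwise. -/
noncomputable def actionReward {k : ℕ} : HState n → Fin k → ℝ
  | s _, a => if a.val = 0 then 0 else ((1 : ℝ) / 2 ^ n) / 2 ^ (k - 1 - a.val)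
  | _, _ => 0

/-- The expected reward for entering a terminal state from a non-terminal one: `tNeg` is entered
with reward `-1`. -/
noncomputable def entryReward {k : ℕ} : HState n → Fin k → ℝ
  | s i, a => transProb (s i) a tNeg * (-1)
  | p i, a => transProb (p i) a tNeg * (-1)
  | _, _ => 0

theorem transProb_nonneg {k : ℕ} (x : HState n) (a : Fin k) (y : HState n) : 0 ≤ transProb x a y := by
  cases x <;> simp only [transProb] <;> split_ifs <;> norm_num

theorem transProb_sum {k : ℕ} (x : HState n) (a : Fin k) : ∑ y, transProb x a y = 1 := by
  cases x
  · simp only [transProb, Finset.sum_ite_eq', Finset.mem_univ, if_true]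
  · simp only [transProb, Finset.sum_add_distrib, Finset.sum_ite_eq',
      Finset.mem_univ, if_true]
    norm_num
  · simp only [transProb, Finset.sum_ite_eq', Finset.mem_univ, if_true]
  · simp only [transProb, Finset.sum_ite_eq', Finset.mem_univ, if_true]

end HState

/-- The MDP `H(n, k)`, in the total reward setting. -/
noncomputable def MDP.H (n k : ℕ) : MDP (HState n) k where
  T := HState.transProb
  R x a := HState.actionReward x a + HState.entryReward x a
  γ := 1
  T_nonneg := HState.transProb_nonneg
  T_sum := HState.transProb_sum
  γ_nonneg := zero_le_one
  γ_le_one := le_rfl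

/-! ### The law of a random run, and drift bounds on the number of iterations. -/

namespace MDP

variable {S : Type} [Fintype S] {k : ℕ} [DecidableEq S]

/-! Let `gap` be the advantage of the partner s'_i over s_{i-1}. It halves from one level to the
next and, up to action rewards, changes sign whenever the action below is nonzero. Except possibly
at the top state it dominates the rewards, so its sign is given by `par`, the parity of the nonzero
actions below. At even parity a larger action is always better (`mem_IA_of_par_false`); at odd
parity action 0 beats every other (`mem_IA_of_par_true`).

Simple PI touches a state only when all higher ones are unimprovable, which makes the zero/nonzero
pattern of the first N states (N = n - 1, or 1 if n = 1) run through a Gray code: `rank`, its binary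
decoding, grows by one with every change between zero and nonzero, from 0 to 2^N - 1 (`rank_update`,
`rank_of_par`). Each state starts at 0, so at least half of these changes leave action 0, and each
departure leads up to action k - 1 before the state returns to 0. The climb takes k - 1 switches
under the index rule and harmonic(k - 1) ≥ log k expected switches under the random rule.

The count is carried out by `potential`, built from the expected remaining climb `h`. It drops by at
most one per iteration (in expectation), so its total decrease bounds the iterations from below
(`ofReal_le_indexIterations`, `ofReal_le_randomExpectedIterations`). -/

theorem map_randomRun (M : MDP S k) (idx : S ↪ ℕ) (π₀ : Policy S k) (t : ℕ) :
    (M.randomRun idx π₀).map (fun x => (Preorder.frestrictLe t x, x (t + 1))) =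
      ((M.randomRun idx π₀).map (Preorder.frestrictLe t)).compProd (M.randomKernel idx t) := by
  have h := Kernel.partialTraj_compProd_eq_map_traj (X := fun _ => Policy S k)
    (κ := M.randomKernel idx) (x₀ := fun _ => π₀) (Nat.zero_le t)
  rw [← Kernel.traj_map_frestrictLe_apply] at h
  exact h.symm

instance (M : MDP S k) (idx : S ↪ ℕ) (π₀ : Policy S k) :
    IsProbabilityMeasure (M.randomRun idx π₀) :=
  inferInstanceAs (IsProbabilityMeasure
    (Kernel.traj (X := fun _ => Policy S k) (M.randomKernel idx) 0 fun _ => π₀))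

theorem ae_randomRun_zero (M : MDP S k) (idx : S ↪ ℕ) (π₀ : Policy S k) :
    ∀ᵐ x ∂M.randomRun idx π₀, x 0 = π₀ := by
  have h := Kernel.traj_map_frestrictLe_apply (X := fun _ => Policy S k)
    (κ := M.randomKernel idx) 0 0 (fun _ => π₀)
  rw [Kernel.partialTraj_self, Kernel.id_apply] at h
  have h2 : ∀ᵐ y ∂(M.randomRun idx π₀).map (Preorder.frestrictLe 0),
      y ⟨0, Finset.mem_Iic.2 le_rfl⟩ = π₀ := by
    rw [randomRun, h, ae_dirac_iff]
    exact (Set.toFinite _).measurableSet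
  exact ae_of_ae_map (Measurable.aemeasurable (by fun_prop)) h2

theorem ae_randomRun_succ (M : MDP S k) (idx : S ↪ ℕ) (π₀ : Policy S k) (t : ℕ) :
    ∀ᵐ x ∂M.randomRun idx π₀, x (t + 1) ∈ (M.randomStep idx (x t)).support := by
  have h : ∀ᵐ q ∂(M.randomRun idx π₀).map (fun x => (Preorder.frestrictLe t x, x (t + 1))),
      q.2 ∈ (M.randomStep idx (q.1 ⟨t, Finset.mem_Iic.2 le_rfl⟩)).support := by
    rw [map_randomRun, Measure.ae_compProd_iff (Set.toFinite _).measurableSet]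
    refine Filter.Eventually.of_forall fun y => ?_
    change ∀ᵐ z ∂(M.randomStep idx (y ⟨t, Finset.mem_Iic.2 le_rfl⟩)).toMeasure,
      z ∈ (M.randomStep idx (y ⟨t, Finset.mem_Iic.2 le_rfl⟩)).support
    rw [ae_iff, PMF.toMeasure_apply_eq_zero_iff _ (Set.toFinite _).measurableSet]
    exact Set.disjoint_left.2 fun z hz hz' => hz' hz
  exact ae_of_ae_map (Measurable.aemeasurable (by fun_prop)) h

theorem integral_randomRun_succ (M : MDP S k) (idx : S ↪ ℕ) (π₀ : Policy S k) (t : ℕ)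
    (f : Policy S k → ℝ) :
    ∫ x, f (x (t + 1)) ∂M.randomRun idx π₀ =
      ∫ x, (∫ π, f π ∂(M.randomStep idx (x t)).toMeasure) ∂M.randomRun idx π₀ := by
  have hm : Measurable (fun x : ℕ → Policy S k =>
      (Preorder.frestrictLe (π := fun _ => Policy S k) t x, x (t + 1))) := by
    fun_prop
  have e1 : ∫ x, f (x (t + 1)) ∂M.randomRun idx π₀ =
      ∫ q, f q.2 ∂(M.randomRun idx π₀).map
        (fun x => (Preorder.frestrictLe (π := fun _ => Policy S k) t x, x (t + 1))) := by
    rw [integral_map hm.aemeasurable (Measurable.of_discrete).aestronglyMeasurable]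
  rw [e1, map_randomRun, Measure.integral_compProd Integrable.of_finite,
    integral_map (Measurable.aemeasurable (by fun_prop))
      (Measurable.of_discrete).aestronglyMeasurable]
  rfl

theorem integral_randomStep (M : MDP S k) (idx : S ↪ ℕ) (π : Policy S k)
    (h : (M.IS π).Nonempty) (f : Policy S k → ℝ) :
    ∫ ρ, f ρ ∂(M.randomStep idx π).toMeasure =
      ((M.IA π (M.simpleState idx π h)).card : ℝ)⁻¹ *
        ∑ a ∈ M.IA π (M.simpleState idx π h),
          f (Function.update π (M.simpleState idx π h) a) := by
  rw [randomStep, dif_pos h, ← PMF.toMeasure_map (hf := Measurable.of_discrete),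
    integral_map Measurable.of_discrete.aemeasurable
      (Measurable.of_discrete).aestronglyMeasurable, PMF.integral_eq_sum, Finset.mul_sum,
    ← Finset.sum_subset (Finset.subset_univ (M.IA π (M.simpleState idx π h)))]
  · refine Finset.sum_congr rfl fun a ha => ?_
    simp [PMF.uniformOfFinset_apply, ha]
  · intro a _ ha
    simp [PMF.uniformOfFinset_apply, ha]

/-- A potential that drops by at most one in expectation at each step of Simple PI with random
action selection bounds the expected number of iterations from below. -/
theorem ofReal_le_randomExpectedIterations (M : MDP S k) (idx : S ↪ ℕ) (π₀ : Policy S k)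
    (Inv : Policy S k → Prop) (Φ : Policy S k → ℝ) (C : ℝ) (h₀ : Inv π₀)
    (hInv : ∀ π, Inv π → ∀ h : (M.IS π).Nonempty, ∀ a ∈ M.IA π (M.simpleState idx π h),
      Inv (Function.update π (M.simpleState idx π h) a))
    (hΦ : ∀ π, Inv π → ∀ h : (M.IS π).Nonempty,
      Φ π - 1 ≤ ((M.IA π (M.simpleState idx π h)).card : ℝ)⁻¹ *
        ∑ a ∈ M.IA π (M.simpleState idx π h), Φ (Function.update π (M.simpleState idx π h) a))
    (hC : ∀ π, Inv π → M.IS π = ∅ → Φ π ≤ C) :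
    ENNReal.ofReal (Φ π₀ - C) ≤ M.randomExpectedIterations idx π₀ := by
  classical
  set P := M.randomRun idx π₀ with hP
  have hstep : ∀ᵐ x ∂P, ∀ t, x (t + 1) ∈ (M.randomStep idx (x t)).support :=
    ae_all_iff.2 fun t => M.ae_randomRun_succ idx π₀ t
  have hfix : ∀ᵐ x ∂P, ∀ t, M.IS (x t) = ∅ → x (t + 1) = x t := by
    filter_upwards [hstep] with x hx t ht
    have := hx t
    rw [randomStep, dif_neg (by simp [ht])] at this
    simpa using this
  have hinv : ∀ᵐ x ∂P, ∀ t, Inv (x t) := by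
    filter_upwards [hstep, M.ae_randomRun_zero idx π₀] with x hx hx0 t
    induction t with
    | zero => rwa [hx0]
    | succ t ih =>
      have := hx t
      by_cases h : (M.IS (x t)).Nonempty
      · rw [randomStep, dif_pos h, PMF.mem_support_map_iff] at this
        obtain ⟨a, ha, hax⟩ := this
        rw [← hax]
        exact hInv _ ih h a ((PMF.mem_support_uniformOfFinset_iff _ _).1 ha)
      · rw [randomStep, dif_neg h] at this
        rw [show x (t + 1) = x t by simpa using this]
        exact ih
  -- Indicator that the run has not stopped; its expectations sum to at most the expected number of
  -- iterations.
  let g : Policy S k → ℝ := fun π => if M.IS π = ∅ then 0 else 1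
  have hg0 : ∀ π, 0 ≤ g π := fun π => by simp only [g]; split_ifs <;> norm_num
  have hint : ∀ (f : Policy S k → ℝ) (t : ℕ), Integrable (fun x : ℕ → Policy S k => f (x t)) P := by
    intro f t
    have : Integrable f (P.map fun x => x t) := by
      have : IsProbabilityMeasure (P.map fun x : ℕ → Policy S k => x t) :=
        Measure.isProbabilityMeasure_map (Measurable.aemeasurable (by fun_prop))
      exact Integrable.of_finite
    exact this.comp_aemeasurable (Measurable.aemeasurable (by fun_prop))
  have hdrop : ∀ t, ∫ x, Φ (x t) ∂P - ∫ x, g (x t) ∂P ≤ ∫ x, Φ (x (t + 1)) ∂P := by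
    intro t
    rw [hP, M.integral_randomRun_succ idx π₀ t Φ, ← hP, ← integral_sub (hint Φ t) (hint g t)]
    refine integral_mono_ae ((hint Φ t).sub (hint g t))
      (hint (fun π => ∫ ρ, Φ ρ ∂(M.randomStep idx π).toMeasure) t) ?_
    filter_upwards [hinv] with x hx
    by_cases h : (M.IS (x t)).Nonempty
    · have h1 : g (x t) = 1 := if_neg h.ne_empty
      simp only [h1, M.integral_randomStep idx _ h]
      exact hΦ _ (hx t) h
    · have h1 : g (x t) = 0 := if_pos (Finset.not_nonempty_iff_eq_empty.1 h)
      simp [h1, randomStep, dif_neg h, PMF.toMeasure_pure]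
  obtain ⟨B, hB⟩ : ∃ B : ℝ, ∀ π, Φ π - C ≤ B := by
    obtain ⟨B, hB⟩ := (Set.finite_range fun π => Φ π - C).bddAbove
    exact ⟨B, fun π => hB ⟨π, rfl⟩⟩
  -- Φ exceeds C only on runs still going, and by a bounded amount since there are finitely many
  -- policies.
  have hend : ∀ t, ∫ x, Φ (x t) ∂P ≤ C + max B 0 * ∫ x, g (x t) ∂P := by
    intro t
    have : C + max B 0 * ∫ x, g (x t) ∂P = ∫ x, (C + max B 0 * g (x t)) ∂P := by
      rw [integral_add (integrable_const _) ((hint g t).const_mul _), integral_const_mul]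
      simp
    rw [this]
    refine integral_mono_ae (hint Φ t) (hint (fun π => C + max B 0 * g π) t) ?_
    filter_upwards [hinv] with x hx
    by_cases h : M.IS (x t) = ∅
    · simpa [g, h] using hC _ (hx t) h
    · have := hB (x t)
      simp only [g, if_neg h, mul_one]
      linarith [le_max_left B 0]
  have hsum : ∀ T, Φ π₀ - ∑ t ∈ Finset.range T, ∫ x, g (x t) ∂P ≤ ∫ x, Φ (x T) ∂P := by
    intro T
    induction T with
    | zero =>
      have : ∫ x, Φ (x 0) ∂P = Φ π₀ := by
        rw [integral_congr_ae (g := fun _ => Φ π₀)]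
        · simp
        · filter_upwards [M.ae_randomRun_zero idx π₀] with x hx
          rw [hx]
      simp [this]
    | succ T ih =>
      rw [Finset.sum_range_succ]
      linarith [hdrop T]
  have hiter : ∑' t, ∫⁻ x, ENNReal.ofReal (g (x t)) ∂P ≤ M.randomExpectedIterations idx π₀ := by
    have hgm : ∀ t, Measurable fun x : ℕ → Policy S k => ENNReal.ofReal (g (x t)) := fun t =>
      (Measurable.of_discrete (f := fun π => ENNReal.ofReal (g π))).comp (measurable_pi_apply t)
    rw [← lintegral_tsum fun t => (hgm t).aemeasurable, randomExpectedIterations]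
    refine lintegral_mono_ae ?_
    filter_upwards [hfix] with x hx
    by_cases hex : ∃ m, M.IS (x m) = ∅
    · let m := Nat.find hex
      have hm : M.IS (x m) = ∅ := Nat.find_spec hex
      have hafter : ∀ t, m ≤ t → M.IS (x t) = ∅ := fun t ht => by
        induction t, ht using Nat.le_induction with
        | base => exact hm
        | succ t _ ih => rw [hx t ih]; exact ih
      have hle : (m : ℕ∞) ≤ M.iterations x :=
        le_iInf₂ fun t ht => by exact_mod_cast Nat.find_min' hex ht
      rw [tsum_eq_sum (s := Finset.range m)]
      · calc ∑ t ∈ Finset.range m, ENNReal.ofReal (g (x t))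
            ≤ ∑ t ∈ Finset.range m, 1 := Finset.sum_le_sum fun t _ => by
              rw [← ENNReal.ofReal_one]
              refine ENNReal.ofReal_le_ofReal ?_
              simp only [g]; split_ifs <;> norm_num
          _ = ((m : ℕ∞) : ℝ≥0∞) := by simp
          _ ≤ _ := by exact_mod_cast hle
      · intro t ht
        simp [g, hafter t (by simpa using ht)]
    · have : M.iterations x = ⊤ := by
        rw [iterations, iInf₂_eq_top]
        exact fun t ht => (hex ⟨t, ht⟩).elim
      simp [this]
  refine le_trans ?_ hiter
  have hlint : ∀ t, ∫⁻ x, ENNReal.ofReal (g (x t)) ∂P = ENNReal.ofReal (∫ x, g (x t) ∂P) :=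
    fun t => (ofReal_integral_eq_lintegral_ofReal (hint g t)
      (Filter.Eventually.of_forall fun x => hg0 _)).symm
  simp_rw [hlint]
  have hnn : ∀ t, 0 ≤ ∫ x, g (x t) ∂P := fun t => integral_nonneg fun x => hg0 _
  -- Termination is not assumed: if the survival probabilities are summable they tend to 0 and the
  -- error term in `hend` vanishes; otherwise the expectation is infinite.
  by_cases hs : Summable fun t => ∫ x, g (x t) ∂P
  · rw [← ENNReal.ofReal_tsum_of_nonneg hnn hs]
    refine ENNReal.ofReal_le_ofReal ?_
    have h1 : ∀ T, Φ π₀ - C ≤ ∑ t ∈ Finset.range T, ∫ x, g (x t) ∂P +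
        max B 0 * ∫ x, g (x T) ∂P := fun T => by linarith [hsum T, hend T]
    have h2 := hs.hasSum.tendsto_sum_nat.add (hs.tendsto_atTop_zero.const_mul (max B 0))
    rw [mul_zero, add_zero] at h2
    exact ge_of_tendsto' h2 h1
  · have htop : ∑' t, ENNReal.ofReal (∫ x, g (x t) ∂P) = ⊤ := by
      by_contra hne
      refine hs ?_
      have := ENNReal.summable_toReal hne
      simpa [ENNReal.toReal_ofReal (hnn _)] using this
    rw [htop]
    exact le_top

/-- A potential that drops by at most one at each step of Simple PI with index-based action
selection bounds the number of iterations from below. -/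
theorem ofReal_le_indexIterations (M : MDP S k) (idx : S ↪ ℕ) (π₀ : Policy S k)
    (Inv : Policy S k → Prop) (Φ : Policy S k → ℝ) (C : ℝ) (h₀ : Inv π₀)
    (hInv : ∀ π, Inv π → ∀ h : (M.IS π).Nonempty, ∀ a ∈ M.IA π (M.simpleState idx π h),
      Inv (Function.update π (M.simpleState idx π h) a))
    (hΦ : ∀ π, Inv π → (M.IS π).Nonempty → Φ π - 1 ≤ Φ (M.indexStep idx π))
    (hC : ∀ π, Inv π → M.IS π = ∅ → Φ π ≤ C) :
    ENNReal.ofReal (Φ π₀ - C) ≤ ((M.indexIterations idx π₀ : ℕ∞) : ℝ≥0∞) := by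
  have key : ∀ t : ℕ, Inv ((M.indexStep idx)^[t] π₀) ∧
      Φ π₀ - t ≤ Φ ((M.indexStep idx)^[t] π₀) := by
    intro t
    induction t with
    | zero => simpa using h₀
    | succ t ih =>
      rw [Function.iterate_succ_apply']
      by_cases h : (M.IS ((M.indexStep idx)^[t] π₀)).Nonempty
      · refine ⟨?_, ?_⟩
        · rw [indexStep, dif_pos h]
          exact hInv _ ih.1 h _ (Finset.min'_mem _ _)
        · push_cast
          linarith [ih.2, hΦ _ ih.1 h]
      · rw [indexStep, dif_neg h]
        refine ⟨ih.1, ?_⟩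
        push_cast
        linarith [ih.2]
  by_cases htop : M.indexIterations idx π₀ = ⊤
  · simp [htop]
  obtain ⟨m, hm⟩ := ENat.ne_top_iff_exists.1 htop
  have hle : (⌈Φ π₀ - C⌉₊ : ℕ∞) ≤ M.indexIterations idx π₀ :=
    le_iInf₂ fun t ht => by
      have := hC _ (key t).1 ht
      exact_mod_cast Nat.ceil_le.2 (by linarith [(key t).2])
  rw [← hm] at hle ⊢
  have h1 : ⌈Φ π₀ - C⌉₊ ≤ m := by exact_mod_cast hle
  rw [ENat.toENNReal_coe, ← ENNReal.ofReal_natCast]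
  exact ENNReal.ofReal_le_ofReal (Nat.ceil_le.1 h1)

end MDP

/-! ### Bellman equation and values on H(n, k). -/

namespace MDP

variable {S : Type} [Fintype S] {k : ℕ}

/-- The Bellman equation, when the expected rewards from every state vanish eventually. -/
theorem V_eq_Q (M : MDP S k) (π : Policy S k)
    (hfin : ∀ s, ∃ m, ∀ t, m ≤ t → M.expReward π t s = 0) (s : S) :
    M.V π s = M.Q π s (π s) := by
  have hsum : ∀ s, Summable fun t : ℕ => M.γ ^ t * M.expReward π t s := fun s => by
    obtain ⟨m, hm⟩ := hfin s
    refine summable_of_ne_finset_zero (s := Finset.range m) fun t ht => ?_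
    rw [hm t (by simpa using ht), mul_zero]
  rw [V, (hsum s).tsum_eq_zero_add, Q]
  simp only [pow_zero, one_mul, expReward, V]
  congr 1
  simp_rw [← tsum_mul_left]
  rw [← Summable.tsum_finsetSum fun s' _ => (hsum s').mul_left _, ← tsum_mul_left]
  refine tsum_congr fun t => ?_
  rw [pow_succ, Finset.mul_sum, Finset.mul_sum]
  exact Finset.sum_congr rfl fun s' _ => by ring

end MDP

namespace HState

variable {n k : ℕ}

/-- A bound on the number of steps until a terminal state is entered. -/
def height : HState n → ℕ
  | s i => 2 * i + 2
  | p i => 2 * i + 1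
  | tNeg => 0
  | tZero => 0

theorem height_prev (i : Fin n) : (prev i).height ≤ 2 * i := by
  unfold prev
  split_ifs with h
  · simp [height]
  · simp only [height]; omega

theorem height_prevPrev (i : Fin n) : (prevPrev i).height ≤ 2 * i := by
  unfold prevPrev
  split_ifs with h
  · simp [height]
  · simp only [height]; omega

theorem height_prevPartner (i : Fin n) : (prevPartner i).height ≤ 2 * i := by
  unfold prevPartner
  split_ifs with h
  · simp [height]
  · simp only [height]; omega

/-- Truncated subtraction lets the bound cover the terminal states, which have height 0 and stay
put. -/
theorem height_le_of_transProb_ne_zero {x y : HState n} {a : Fin k} (h : transProb x a y ≠ 0) :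
    y.height ≤ x.height - 1 := by
  cases x with
  | s i =>
    have hy : y = if a.val = 0 then prev i else p i := by
      by_contra hne
      exact h (if_neg hne)
    rw [hy]
    split_ifs
    · exact (height_prev i).trans (by simp only [height]; omega)
    · simp [height]
  | p i =>
    by_cases h1 : y = prevPartner i
    · rw [h1]; exact height_prevPartner i
    · by_cases h2 : y = prevPrev i
      · rw [h2]; exact height_prevPrev i
      · exact absurd (by simp [transProb, h1, h2]) h
  | tNeg =>
    have hy : y = tNeg := by
      by_contra hne
      exact h (if_neg hne)
    simp [hy, height]
  | tZero =>
    have hy : y = tZero := by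
      by_contra hne
      exact h (if_neg hne)
    simp [hy, height]

theorem expReward_eq_zero (π : MDP.Policy (HState n) k) (t : ℕ) (x : HState n)
    (h : x.height ≤ t) : (MDP.H n k).expReward π t x = 0 := by
  induction t generalizing x with
  | zero => cases x <;> simp_all [height, MDP.expReward, MDP.H, actionReward, entryReward]
  | succ t ih =>
    refine Finset.sum_eq_zero fun y _ => ?_
    by_cases hy : transProb x (π x) y = 0
    · exact mul_eq_zero_of_left hy _
    · rw [ih y ((height_le_of_transProb_ne_zero hy).trans (by omega)), mul_zero]

/-- The value of being sent to a state, including the reward for entering `tNeg`. -/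
noncomputable def entryValue (π : MDP.Policy (HState n) k) (x : HState n) : ℝ :=
  (if x = tNeg then -1 else 0) + (MDP.H n k).V π x

theorem V_eq_Q (π : MDP.Policy (HState n) k) (x : HState n) :
    (MDP.H n k).V π x = (MDP.H n k).Q π x (π x) :=
  (MDP.H n k).V_eq_Q π (fun y => ⟨y.height, fun t => expReward_eq_zero π t y⟩) x

theorem V_of_height_eq_zero (π : MDP.Policy (HState n) k) {x : HState n} (h : x.height = 0) :
    (MDP.H n k).V π x = 0 := by
  simp [MDP.V, expReward_eq_zero π _ x (h.le.trans (Nat.zero_le _))]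

theorem Q_s (π : MDP.Policy (HState n) k) (i : Fin n) (a : Fin k) :
    (MDP.H n k).Q π (s i) a = if a.val = 0 then entryValue π (prev i)
      else (1 : ℝ) / 2 ^ n / 2 ^ (k - 1 - a.val) + (MDP.H n k).V π (p i) := by
  simp only [MDP.Q, MDP.H, actionReward, entryReward, transProb, one_mul, ite_mul, zero_mul,
    Finset.sum_ite_eq', Finset.mem_univ, if_true, entryValue]
  split_ifs <;> simp_all

theorem V_p (π : MDP.Policy (HState n) k) (i : Fin n) :
    (MDP.H n k).V π (p i) =
      (entryValue π (prevPartner i) + entryValue π (prevPrev i)) / 2 := by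
  rw [V_eq_Q]
  have hne : prevPartner i ≠ tNeg := by unfold prevPartner; split_ifs <;> simp
  have h1 : (MDP.H n k).Q π (p i) (π (p i)) = (if tNeg = prevPrev i then 1 / 2 else 0) * (-1) +
      (1 / 2 * (MDP.H n k).V π (prevPartner i) + 1 / 2 * (MDP.H n k).V π (prevPrev i)) := by
    simp only [MDP.Q, MDP.H, actionReward, entryReward, transProb, one_mul, ite_mul, zero_mul,
      Finset.sum_ite_eq', Finset.mem_univ, if_true, add_mul, Finset.sum_add_distrib,
      if_neg hne.symm, zero_add]
  rw [h1, entryValue, entryValue, if_neg hne]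
  by_cases h : prevPrev i = tNeg
  · simp only [h, if_true]; ring
  · simp only [h, Ne.symm h, if_false]; ring

/-! ### The gap recursion and its sign. -/

/-- The number of the action that a policy takes at the `i`-th state, `0` when there is none. -/
def act (π : MDP.Policy (HState n) k) (i : ℕ) : ℕ :=
  if h : i < n then (π (s ⟨i, h⟩)).val else 0

/-- The reward of the nonzero action `a`. -/
noncomputable def rew (n k a : ℕ) : ℝ := (1 : ℝ) / 2 ^ n / 2 ^ (k - 1 - a)

/-- The advantage of moving to the partner state over action `0`, action rewards excluded, when
the `i`-th state takes action `α i`. -/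
noncomputable def gap (n k : ℕ) (α : ℕ → ℕ) : ℕ → ℝ
  | 0 => 1 / 2
  | i + 1 => if α i = 0 then gap n k α i / 2 else -gap n k α i / 2 - rew n k (α i)

/-- The successors of s'_{i+1} are s'_i and s_{i-1}, exactly the two states between which s_i
chooses, so the difference at level i + 1 is expressed by the one at level i. -/
theorem V_p_sub_entryValue_prev (π : MDP.Policy (HState n) k) (i : ℕ) (hi : i < n) :
    (MDP.H n k).V π (p ⟨i, hi⟩) - entryValue π (prev ⟨i, hi⟩) = gap n k (act π) i := by
  induction i with
  | zero =>
    have h1 : prevPartner (⟨0, hi⟩ : Fin n) = tZero := rfl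
    have h2 : prevPrev (⟨0, hi⟩ : Fin n) = tNeg := rfl
    have h3 : prev (⟨0, hi⟩ : Fin n) = tNeg := rfl
    simp only [V_p, h1, h2, h3, entryValue, V_of_height_eq_zero π (x := tNeg) rfl,
      V_of_height_eq_zero π (x := tZero) rfl, gap, if_true,
      reduceCtorEq, if_false]
    norm_num
  | succ i ih =>
    have hi' : i < n := by omega
    have h1 : prevPartner (⟨i + 1, hi⟩ : Fin n) = p ⟨i, hi'⟩ := by simp [prevPartner]
    have h2 : prevPrev (⟨i + 1, hi⟩ : Fin n) = prev ⟨i, hi'⟩ := by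
      by_cases h : i = 0
      · simp [prevPrev, prev, h]
      · rw [prevPrev, prev, dif_neg (by simp only; omega), dif_neg h]
        simp
    have h3 : prev (⟨i + 1, hi⟩ : Fin n) = s ⟨i, hi'⟩ := by simp [prev]
    have h4 : entryValue π (p ⟨i, hi'⟩) = (MDP.H n k).V π (p ⟨i, hi'⟩) := by simp [entryValue]
    have h5 : entryValue π (s ⟨i, hi'⟩) = (MDP.H n k).V π (s ⟨i, hi'⟩) := by simp [entryValue]
    have h6 : act π i = (π (s ⟨i, hi'⟩)).val := dif_pos hi'
    rw [V_p, h1, h2, h3, h4, h5, V_eq_Q π (s _), Q_s, gap, ← ih hi', h6]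
    split_ifs
    · ring
    · rw [rew]; ring

theorem Q_s_sub (π : MDP.Policy (HState n) k) (i : Fin n) (a : Fin k) :
    (MDP.H n k).Q π (s i) a - entryValue π (prev i) =
      if a.val = 0 then 0 else gap n k (act π) i + rew n k a.val := by
  rw [Q_s, ← V_p_sub_entryValue_prev π i i.2, rew]
  split_ifs <;> ring

theorem not_mem_IS_p (π : MDP.Policy (HState n) k) (i : Fin n) : p i ∉ (MDP.H n k).IS π := by
  simp [MDP.IS, MDP.Q, MDP.H, actionReward, entryReward, transProb]

theorem not_mem_IS_tNeg (π : MDP.Policy (HState n) k) : tNeg ∉ (MDP.H n k).IS π := by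
  simp [MDP.IS, MDP.Q, MDP.H, actionReward, entryReward, transProb]

theorem not_mem_IS_tZero (π : MDP.Policy (HState n) k) : tZero ∉ (MDP.H n k).IS π := by
  simp [MDP.IS, MDP.Q, MDP.H, actionReward, entryReward, transProb]

/-- Whether an odd number of the states below the `i`-th one take a nonzero action. -/
def par (α : ℕ → ℕ) : ℕ → Bool
  | 0 => false
  | i + 1 => xor (par α i) (α i ≠ 0)

theorem rew_pos (n k a : ℕ) : 0 < rew n k a := by unfold rew; positivity

theorem rew_le (n k a : ℕ) : rew n k a ≤ 1 / 2 ^ n :=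
  div_le_self (by positivity) (one_le_pow₀ one_le_two)

theorem rew_lt_rew {a b : ℕ} (hab : a < b) (hb : b < k) : rew n k a < rew n k b :=
  div_lt_div_of_pos_left (by positivity) (by positivity)
    (pow_lt_pow_right₀ one_lt_two (by omega))

/-- Errors are halved at each level, and a reward of at most ε is lost when parity turns from odd to
even. The constants solve x = y/2 and y = x/2 + 1, whence x = 2/3 and y = 4/3. -/
theorem gap_bound (n k : ℕ) (α : ℕ → ℕ) (i : ℕ) :
    if par α i then gap n k α i ≤ -(1 / 2 ^ (i + 1) - 2 / 3 * (1 / 2 ^ n))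
    else 1 / 2 ^ (i + 1) - 4 / 3 * (1 / 2 ^ n) ≤ gap n k α i := by
  have hε : (0 : ℝ) < 1 / 2 ^ n := by positivity
  induction i with
  | zero =>
    rw [par, if_neg (by simp), gap]
    norm_num
  | succ i ih =>
    have hp : (1 : ℝ) / 2 ^ (i + 1 + 1) = 1 / 2 ^ (i + 1) / 2 := by rw [pow_succ, div_div]
    have h1 := rew_pos n k (α i)
    have h2 := rew_le n k (α i)
    rw [hp]
    generalize (1 : ℝ) / 2 ^ (i + 1) = e at ih ⊢
    by_cases ha : α i = 0 <;> cases hpar : par α i <;>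
      simp [par, gap, ha, hpar] at ih ⊢ <;> simp only [one_div] at * <;> linarith

/-- The first `N` states, whose improving actions are determined by `par`. -/
def Controlled (n N : ℕ) : Prop := N ≤ n ∧ (n = 1 ∨ N + 1 ≤ n)

/-- The errors are harmless once 2ε ≤ 2^{-(i+1)}. This fails at the top state i = n - 1, which
`Controlled` therefore excludes unless n = 1, where the gap is 1/2. -/
theorem gap_of_par {N : ℕ} (hN : Controlled n N) {i : ℕ} (hi : i < N) (α : ℕ → ℕ) :
    (par α i = false → 0 < gap n k α i) ∧ (par α i = true → gap n k α i < -(1 / 2 ^ n)) := by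
  rcases hN with ⟨h1, h2 | h2⟩
  · obtain rfl : i = 0 := by omega
    simp [par, gap]
  · have hle : 2 * ((1 : ℝ) / 2 ^ n) ≤ 1 / 2 ^ (i + 1) := by
      have h3 : (1 : ℝ) / 2 ^ n ≤ 1 / 2 ^ (i + 1 + 1) :=
        one_div_le_one_div_of_le (by positivity) (pow_le_pow_right₀ one_le_two (by omega))
      rw [pow_succ _ (i + 1), ← div_div] at h3
      linarith
    have hε : (0 : ℝ) < 1 / 2 ^ n := by positivity
    have := gap_bound n k α i
    constructor <;> intro h <;> simp only [h, if_true, if_false, Bool.false_eq_true] at this <;>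
      linarith

end HState

/-! ### Improving actions and unimprovable states. -/

namespace HState

variable {n k : ℕ}

theorem act_val (π : MDP.Policy (HState n) k) (i : Fin n) : act π i = (π (s i)).val :=
  dif_pos i.2

theorem mem_IA_s (π : MDP.Policy (HState n) k) (i : Fin n) (a : Fin k) :
    a ∈ (MDP.H n k).IA π (s i) ↔
      (if act π i = 0 then 0 else gap n k (act π) i + rew n k (act π i)) <
        if a.val = 0 then 0 else gap n k (act π) i + rew n k a.val := by
  rw [act_val, ← Q_s_sub, ← Q_s_sub, sub_lt_sub_iff_right]
  simp [MDP.IA]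

theorem mem_IA_of_par_false {N : ℕ} (hN : Controlled n N) (π : MDP.Policy (HState n) k) {i : Fin n}
    (hi : i.val < N) (hpar : par (act π) i = false) (a : Fin k) :
    a ∈ (MDP.H n k).IA π (s i) ↔ act π i < a.val := by
  have hg := (gap_of_par (k := k) hN hi (act π)).1 hpar
  have hb : act π i < k := act_val π i ▸ (π (s i)).2
  rw [mem_IA_s]
  have h1 := rew_pos n k (act π i)
  have h2 := rew_pos n k a.val
  rcases lt_trichotomy (act π i) a.val with h | h | h
  · have h3 := rew_lt_rew (n := n) h a.2
    rw [if_neg (by omega : a.val ≠ 0)]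
    simp only [h, iff_true]
    split_ifs <;> linarith
  · simp [h]
  · have h3 := rew_lt_rew (n := n) h hb
    rw [if_neg (by omega : act π i ≠ 0)]
    simp only [h.not_gt, iff_false, not_lt]
    split_ifs <;> linarith

theorem mem_IA_of_par_true {N : ℕ} (hN : Controlled n N) (π : MDP.Policy (HState n) k) {i : Fin n}
    (hi : i.val < N) (hpar : par (act π) i = true) (a : Fin k) :
    a ∈ (MDP.H n k).IA π (s i) ↔ act π i ≠ 0 ∧ (a.val = 0 ∨ act π i < a.val) := by
  have hg := (gap_of_par (k := k) hN hi (act π)).2 hpar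
  have hb : act π i < k := act_val π i ▸ (π (s i)).2
  rw [mem_IA_s]
  have h1 := rew_le n k (act π i)
  have h2 := rew_le n k a.val
  by_cases h0 : act π i = 0
  · simp only [h0, if_true, ne_eq, not_true, false_and, iff_false, not_lt]
    split_ifs <;> linarith
  by_cases ha : a.val = 0
  · simp only [h0, ha, if_true, if_false, ne_eq, not_false_iff, true_or, true_and, iff_true]
    linarith
  rw [if_neg h0, if_neg ha]
  simp only [h0, ha, ne_eq, not_false_iff, true_and, false_or, add_lt_add_iff_left]
  rcases lt_trichotomy (act π i) a.val with h | h | h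
  · simp [h, rew_lt_rew (n := n) h a.2]
  · simp [h]
  · simp [h.not_gt, (rew_lt_rew (n := n) h hb).le]

theorem mem_IS_s (π : MDP.Policy (HState n) k) (i : Fin n) :
    s i ∈ (MDP.H n k).IS π ↔ ∃ a, a ∈ (MDP.H n k).IA π (s i) := by
  simp [MDP.IS, MDP.IA]

/-- Nonzero actions at the first `N` states that are no longer optimal are the last action. -/
def Stale (k N : ℕ) (α : ℕ → ℕ) : Prop :=
  ∀ i < N, par α i = true → α i ≠ 0 → α i = k - 1

theorem act_of_not_mem_IS (hk : 2 ≤ k) {N : ℕ} (hN : Controlled n N)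
    (π : MDP.Policy (HState n) k) {i : Fin n} (hi : i.val < N) (hs : s i ∉ (MDP.H n k).IS π) :
    act π i = if par (act π) i then 0 else k - 1 := by
  rw [mem_IS_s, not_exists] at hs
  have hb : act π i < k := act_val π i ▸ (π (s i)).2
  cases hpar : par (act π) i
  · have := hs ⟨k - 1, by omega⟩
    rw [mem_IA_of_par_false hN π hi hpar] at this
    simp only [Bool.false_eq_true, if_false]
    simp only at this
    omega
  · have := hs ⟨0, by omega⟩
    rw [mem_IA_of_par_true hN π hi hpar] at this
    simpa using this

/-- At even parity the action is k - 1 ≠ 0 and flips the parity; at odd parity it is 0 and keeps it.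
-/
theorem par_succ_of_not_mem_IS (hk : 2 ≤ k) {N : ℕ} (hN : Controlled n N)
    (π : MDP.Policy (HState n) k) {i : Fin n} (hi : i.val < N) (hs : s i ∉ (MDP.H n k).IS π) :
    par (act π) (i + 1) = true := by
  have := act_of_not_mem_IS hk hN π hi hs
  rw [par]
  cases hpar : par (act π) i <;> simp only [hpar, if_true, Bool.false_eq_true, if_false] at this
  · simp [this]; omega
  · simp [this]

theorem act_update (π : MDP.Policy (HState n) k) (i : Fin n) (a : Fin k) :
    act (Function.update π (s i) a) = Function.update (act π) i a.val := by
  funext j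
  by_cases hj : j = i
  · subst hj
    rw [Function.update_self, act_val, Function.update_self]
  · rw [Function.update_of_ne hj]
    unfold act
    split_ifs with h
    · rw [Function.update_of_ne]
      simp only [ne_eq, s.injEq, Fin.ext_iff]
      exact hj
    · rfl

theorem par_congr {α β : ℕ → ℕ} {i : ℕ} (h : ∀ j < i, α j = 0 ↔ β j = 0) : par α i = par β i := by
  induction i with
  | zero => rfl
  | succ i ih => simp [par, ih fun j hj => h j (by omega), h i (by omega)]

theorem par_update_of_le (α : ℕ → ℕ) {i j : ℕ} (hj : j ≤ i) (b : ℕ) :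
    par (Function.update α i b) j = par α j :=
  par_congr fun l hl => by rw [Function.update_of_ne (by omega)]

theorem par_update_of_lt {α : ℕ → ℕ} {i j b : ℕ} (hj : i < j) (hb : α i = 0 ↔ b ≠ 0) :
    par (Function.update α i b) j = !par α j := by
  induction j, hj using Nat.le_induction with
  | base =>
    rw [par, par, par_update_of_le α le_rfl, Function.update_self]
    by_cases h : b = 0 <;> simp [h] at hb <;> simp [h, hb]
  | succ j hj ih =>
    rw [par, par, ih, Function.update_of_ne (by omega), Bool.not_xor]

/-! ### Gray code rank and the potential. -/

/-- The number whose binary digits are given by `par`, the first state being the most significant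
one. -/
noncomputable def rank (α : ℕ → ℕ) : ℕ → ℝ
  | 0 => 0
  | i + 1 => 2 * rank α i + if par α (i + 1) then 1 else 0

theorem rank_congr {α β : ℕ → ℕ} {i : ℕ} (h : ∀ j < i, α j = 0 ↔ β j = 0) :
    rank α i = rank β i := by
  induction i with
  | zero => rfl
  | succ i ih => rw [rank, rank, ih fun j hj => h j (by omega), par_congr h]

/-- Changing the zero status at i flips every digit from i on, turning 01…1 into 10…0: a binary
carry. -/
theorem rank_update {α : ℕ → ℕ} {i b : ℕ} (hb : α i = 0 ↔ b ≠ 0) (hi : par α (i + 1) = false)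
    {N : ℕ} (hN : i < N) (hpar : ∀ j, i < j → j < N → par α (j + 1) = true) :
    rank (Function.update α i b) N = rank α N + 1 := by
  induction N, hN using Nat.le_induction with
  | base =>
    rw [rank, rank, par_update_of_lt (Nat.lt_succ_self i) hb, hi,
      rank_congr (β := α) fun l hl => by rw [Function.update_of_ne (by omega)]]
    simp
  | succ N hN ih =>
    rw [rank, rank, ih fun j h1 h2 => hpar j h1 (by omega), par_update_of_lt (by omega) hb,
      hpar N hN (by omega)]
    simp only [Bool.not_true, Bool.false_eq_true, if_false, if_true]
    ring

theorem rank_of_par {α : ℕ → ℕ} {N : ℕ} (h : ∀ i < N, par α (i + 1) = true) :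
    rank α N = 2 ^ N - 1 := by
  induction N with
  | zero => simp [rank]
  | succ N ih => rw [rank, ih fun i hi => h i (by omega), h N (by omega), if_pos rfl]; ring

/-- The contribution of a state taking action `a` to the potential, `h a` being the expected number
of switches to get from action `a` to the last one. -/
noncomputable def weight (h : ℕ → ℝ) (a : ℕ) : ℝ := if a = 0 then 0 else h a - h 0 / 2

/-- A lower bound on the expected number of remaining iterations, up to a constant. -/
noncomputable def potential (N : ℕ) (h : ℕ → ℝ) (α : ℕ → ℕ) : ℝ :=
  h 0 / 2 * (2 ^ N - rank α N) + ∑ i ∈ Finset.range N, weight h (α i)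

theorem sum_weight_update (h : ℕ → ℝ) (α : ℕ → ℕ) {i N : ℕ} (hi : i < N) (b : ℕ) :
    ∑ j ∈ Finset.range N, weight h (Function.update α i b j) =
      ∑ j ∈ Finset.range N, weight h (α j) + (weight h b - weight h (α i)) := by
  rw [← Finset.add_sum_erase _ _ (Finset.mem_range.2 hi),
    ← Finset.add_sum_erase (Finset.range N) (fun j => weight h (α j)) (Finset.mem_range.2 hi),
    Function.update_self, Finset.sum_congr rfl fun j hj => by
      rw [Function.update_of_ne (Finset.ne_of_mem_erase hj)]]
  ring

theorem potential_zero (N : ℕ) (h : ℕ → ℝ) : potential N h (fun _ => 0) = h 0 / 2 * 2 ^ N := by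
  have hp : ∀ i, par (fun _ => 0) i = false := fun i => by
    induction i with
    | zero => rfl
    | succ i ih => simp [par, ih]
  have hr : ∀ i, rank (fun _ => 0) i = 0 := fun i => by
    induction i with
    | zero => rfl
    | succ i ih => simp [rank, ih, hp]
  simp [potential, weight, hr]

/-- At the end the rank is 2^N - 1, leaving h 0 / 2, and every weight is 0 or -h 0 / 2. -/
theorem potential_le_of_IS_eq_empty (hk : 2 ≤ k) {N : ℕ} (hN : Controlled n N) {h : ℕ → ℝ}
    (hlast : h (k - 1) = 0) (h0 : 0 ≤ h 0) (π : MDP.Policy (HState n) k)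
    (hs : (MDP.H n k).IS π = ∅) : potential N h (act π) ≤ h 0 / 2 := by
  have hpar : ∀ i < N, par (act π) (i + 1) = true := fun i hi =>
    par_succ_of_not_mem_IS hk hN π (i := ⟨i, hi.trans_le hN.1⟩) hi (by simp [hs])
  have hw : ∑ i ∈ Finset.range N, weight h (act π i) ≤ 0 := Finset.sum_nonpos fun i hi => by
    have hi := Finset.mem_range.1 hi
    have := act_of_not_mem_IS hk hN π (i := ⟨i, hi.trans_le hN.1⟩) hi (by simp [hs])
    simp only at this
    rw [this]
    cases par (act π) i
    · rw [if_neg (by simp), weight, if_neg (by omega), hlast]; linarith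
    · simp [weight]
  rw [potential, rank_of_par hpar]
  linarith

/-! ### Change of the potential in one iteration. -/

section Step

variable {N : ℕ} {idx : HState n ↪ ℕ} {π : MDP.Policy (HState n) k}

theorem exists_simpleState_eq (hidx : ∀ i j : Fin n, i < j → idx (s i) < idx (s j))
    (h : ((MDP.H n k).IS π).Nonempty) :
    ∃ i : Fin n, (MDP.H n k).simpleState idx π h = s i ∧
      ∀ j, i < j → s j ∉ (MDP.H n k).IS π := by
  have hmem := (MDP.H n k).simpleState_mem idx π h
  have hmax := (MDP.H n k).le_simpleState idx π h
  generalize (MDP.H n k).simpleState idx π h = x at *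
  cases x with
  | s i => exact ⟨i, rfl, fun j hij hj => (hmax _ hj).not_gt (hidx i j hij)⟩
  | p i => exact absurd hmem (not_mem_IS_p π i)
  | tNeg => exact absurd hmem (not_mem_IS_tNeg π)
  | tZero => exact absurd hmem (not_mem_IS_tZero π)

/-- Parity changes only at states above i. These are unimprovable, so their actions are already 0 or
k - 1. -/
theorem stale_update (hk : 2 ≤ k) (hN : Controlled n N) (hπ : Stale k N (act π)) {i : Fin n}
    (habove : ∀ j, i < j → s j ∉ (MDP.H n k).IS π) {a : Fin k}
    (ha : a ∈ (MDP.H n k).IA π (s i)) :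
    Stale k N (act (Function.update π (s i) a)) := by
  intro j hj hpar hne
  rw [act_update] at hpar hne ⊢
  rcases lt_trichotomy j i with h | rfl | h
  · rw [par_update_of_le _ h.le] at hpar
    rw [Function.update_of_ne h.ne] at hne ⊢
    exact hπ j hj hpar hne
  · rw [par_update_of_le _ le_rfl] at hpar
    rw [Function.update_self] at hne ⊢
    rw [mem_IA_of_par_true hN π hj hpar] at ha
    have := hπ i hj hpar ha.1
    have := a.2
    omega
  · rw [Function.update_of_ne h.ne'] at hne ⊢
    have := act_of_not_mem_IS hk hN π (i := ⟨j, hj.trans_le hN.1⟩) hj (habove _ h)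
    simp only at this
    rw [this] at hne ⊢
    split_ifs at hne ⊢
    · exact absurd rfl hne
    · rfl

theorem potential_update_of_le {h : ℕ → ℝ} {i : Fin n} (hi : N ≤ i) (a : Fin k) :
    potential N h (act (Function.update π (s i) a)) = potential N h (act π) := by
  have he : ∀ j < N, Function.update (act π) i a.val j = act π j := fun j hj =>
    Function.update_of_ne (by omega) _ _
  rw [act_update, potential, potential, rank_congr fun j hj => by rw [he j hj],
    Finset.sum_congr rfl fun j hj => by rw [he j (Finset.mem_range.1 hj)]]

/-- Staleness forces the switch from k - 1 to 0. The rank term loses h 0 / 2 and the weight regains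
it, so the return costs nothing. -/
theorem potential_update_of_par_true (hk : 2 ≤ k) (hN : Controlled n N) (hπ : Stale k N (act π))
    {h : ℕ → ℝ} (hlast : h (k - 1) = 0) {i : Fin n} (hi : i.val < N)
    (habove : ∀ j, i < j → s j ∉ (MDP.H n k).IS π) (hpar : par (act π) i = true) {a : Fin k}
    (ha : a ∈ (MDP.H n k).IA π (s i)) :
    potential N h (act (Function.update π (s i) a)) = potential N h (act π) := by
  rw [mem_IA_of_par_true hN π hi hpar] at ha
  have h1 := hπ i hi hpar ha.1
  have h2 : a.val = 0 := by have := a.2; omega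
  rw [act_update, potential, potential, sum_weight_update h _ hi, rank_update _ _ hi]
  · rw [h1, h2, weight, weight, if_pos rfl, if_neg (by omega), hlast]
    ring
  · exact fun j hij hj => par_succ_of_not_mem_IS hk hN π (i := ⟨j, hj.trans_le hN.1⟩) hj
      (habove _ hij)
  · simp [ha.1, h2]
  · simp [par, hpar, ha.1]

/-- Leaving action 0 takes h 0 / 2 from the rank term and h 0 / 2 through the weight, hence h 0 in
all; between nonzero actions the rank is constant. -/
theorem potential_update_of_par_false (hk : 2 ≤ k) (hN : Controlled n N) {h : ℕ → ℝ} {i : Fin n}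
    (hi : i.val < N) (habove : ∀ j, i < j → s j ∉ (MDP.H n k).IS π)
    (hpar : par (act π) i = false) {a : Fin k} (ha : act π i < a.val) :
    potential N h (act (Function.update π (s i) a)) =
      potential N h (act π) + (h a.val - h (act π i)) := by
  rw [act_update, potential, potential, sum_weight_update h _ hi]
  by_cases h0 : act π i = 0
  · rw [rank_update _ _ hi]
    · rw [h0, weight, weight, if_pos rfl, if_neg (by omega)]
      ring
    · exact fun j hij hj => par_succ_of_not_mem_IS hk hN π (i := ⟨j, hj.trans_le hN.1⟩) hj
        (habove _ hij)
    · simp only [h0, true_iff]; omega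
    · simp [par, hpar, h0]
  · rw [rank_congr (β := act π), weight, weight, if_neg (by omega), if_neg h0]
    · ring
    · intro j _
      by_cases hj : j = i
      · subst hj; rw [Function.update_self]; omega
      · rw [Function.update_of_ne hj]

end Step

/-! ### Harmonic averages and the final bounds. -/

theorem exists_controlled (hn : 1 ≤ n) : ∃ N, Controlled n N ∧ 1 ≤ N ∧ n ≤ N + 1 := by
  by_cases h : n = 1
  · exact ⟨1, ⟨h.ge, Or.inl h⟩, le_rfl, by omega⟩
  · exact ⟨n - 1, ⟨by omega, Or.inr (by omega)⟩, by omega, by omega⟩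

/-- The average of the first m of these numbers is harmonic m - 1 for m > 0: a uniformly random
improving action lowers the expected climb by exactly one. -/
theorem sum_harmonic (m : ℕ) :
    ∑ j ∈ Finset.range m, (harmonic j : ℝ) = m * harmonic m - m := by
  induction m with
  | zero => simp
  | succ m ih =>
    rw [Finset.sum_range_succ, ih, harmonic_succ]
    push_cast
    field_simp
    ring

theorem sum_harmonic_filter {m : ℕ} (hm : m < k) :
    ∑ a : Fin k with m < a.val, (harmonic (k - 1 - a.val) : ℝ) =
      (k - 1 - m : ℕ) * harmonic (k - 1 - m) - (k - 1 - m : ℕ) := by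
  rw [← sum_harmonic]
  refine Finset.sum_bij' (fun a _ => k - 1 - a.val)
    (fun j hj => ⟨k - 1 - j, by omega⟩) ?_ ?_ ?_ ?_ ?_
  all_goals simp [Fin.ext_iff]
  all_goals intros
  all_goals omega

theorem card_filter_lt {m : ℕ} (hm : m < k) :
    (Finset.univ.filter fun a : Fin k => m < a.val).card = k - 1 - m := by
  have := Fin.card_Ioi (⟨m, hm⟩ : Fin k)
  rw [← this]
  congr 1
  ext a
  simp [Fin.lt_def]

end HState

open HState in
/-- Lower bounds for Simple PI on `H(n, k)` started from the policy `0^n`, for every indexing of the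
states in which `s_1, …, s_n` have increasing indices. -/
theorem mainTheorem3 :
    ∃ c : ℝ, 0 < c ∧ ∀ (n k : ℕ) (_hn : 1 ≤ n) (hk : 2 ≤ k) (idx : HState n ↪ ℕ)
      (_hidx : ∀ i j : Fin n, i < j → idx (HState.s i) < idx (HState.s j)),
      ENNReal.ofReal (c * (k * 2 ^ n)) ≤
          (((MDP.H n k).indexIterations idx fun _ => ⟨0, by omega⟩ : ℕ∞) : ℝ≥0∞) ∧
        ENNReal.ofReal (c * (Real.log k * 2 ^ n)) ≤
          (MDP.H n k).randomExpectedIterations idx fun _ => ⟨0, by omega⟩ := by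
  refine ⟨1 / 16, by norm_num, fun n k hn hk idx hidx => ?_⟩
  obtain ⟨N, hN, hN1, hnN⟩ := exists_controlled hn
  have hk1 : (2 : ℝ) ≤ k := by exact_mod_cast hk
  have hstart : act (fun _ => ⟨0, by omega⟩ : MDP.Policy (HState n) k) = fun _ => 0 := by
    funext i
    simp [act]
  have hstale : Stale k N (act (fun _ => ⟨0, by omega⟩ : MDP.Policy (HState n) k)) := by
    rw [hstart]
    exact fun i _ _ h => absurd rfl h
  have hinv : ∀ π : MDP.Policy (HState n) k, Stale k N (act π) →
      ∀ h : ((MDP.H n k).IS π).Nonempty,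
        ∀ a ∈ (MDP.H n k).IA π ((MDP.H n k).simpleState idx π h),
          Stale k N (act (Function.update π ((MDP.H n k).simpleState idx π h) a)) := by
    intro π hπ h a ha
    obtain ⟨i, hi, habove⟩ := exists_simpleState_eq hidx h
    rw [hi] at ha ⊢
    exact stale_update hk hN hπ habove ha
  -- The factor 1/16 is 1/2 from h0 / 2, 1/2 from 2^N - 1 ≥ 2^N / 2, 1/2 from b ≤ 2 h0, and 1/2 from
  -- 2^n ≤ 2 · 2^N.
  have hsize : ∀ b h0 : ℝ, 0 ≤ b → b ≤ 2 * h0 →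
      1 / 16 * (b * 2 ^ n) ≤ h0 / 2 * 2 ^ N - h0 / 2 := by
    intro b h0 hb hb0
    have h1 : (2 : ℝ) ^ n ≤ 2 * 2 ^ N := by
      rw [← pow_succ']
      exact pow_le_pow_right₀ one_le_two hnN
    have h2 : (2 : ℝ) ≤ 2 ^ N := by
      simpa using pow_le_pow_right₀ (one_le_two (α := ℝ)) hN1
    nlinarith [mul_le_mul hb0 h1 (by positivity) (by linarith)]
  constructor
  · have hlast : (fun a : ℕ => (k : ℝ) - 1 - a) (k - 1) = 0 := by
      simp [Nat.cast_sub (by omega : 1 ≤ k)]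
    refine le_trans (ENNReal.ofReal_le_ofReal ?_) (MDP.ofReal_le_indexIterations _ idx _
      (fun π => Stale k N (act π)) (fun π => potential N (fun a : ℕ => (k : ℝ) - 1 - a) (act π))
      (((k : ℝ) - 1 - (0 : ℕ)) / 2) hstale hinv ?_ fun π _ hs =>
        potential_le_of_IS_eq_empty hk hN hlast (by simp only [Nat.cast_zero]; linarith) π hs)
    · rw [hstart, potential_zero]
      exact hsize _ _ (by positivity) (by simp only [Nat.cast_zero]; linarith)
    · intro π hπ h
      obtain ⟨i, hi, habove⟩ := exists_simpleState_eq hidx h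
      rw [MDP.indexStep, dif_pos h]
      suffices ∀ a ∈ (MDP.H n k).IA π ((MDP.H n k).simpleState idx π h),
          (∀ b ∈ (MDP.H n k).IA π ((MDP.H n k).simpleState idx π h), a ≤ b) →
          potential N (fun a : ℕ => (k : ℝ) - 1 - a) (act π) - 1 ≤
            potential N (fun a : ℕ => (k : ℝ) - 1 - a)
              (act (Function.update π ((MDP.H n k).simpleState idx π h) a)) from
        this _ (Finset.min'_mem _ _) fun b hb => Finset.min'_le _ b hb
      intro a hmin hle
      rw [hi] at hmin hle ⊢
      rcases le_or_gt N i with hiN | hiN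
      -- Switches at an uncontrolled state leave the potential unchanged and only add iterations.
      · rw [potential_update_of_le hiN]; linarith
      · cases hpar : par (act π) i
        · have hmem := mem_IA_of_par_false hN π hiN hpar
          rw [hmem] at hmin
          rw [potential_update_of_par_false hk hN hiN habove hpar hmin]
          -- The successor of the current action is improving, so the smallest improving action
          -- climbs by at most one.
          have h1 := hle ⟨act π i + 1, by have := a.2; omega⟩ ((hmem _).2 (Nat.lt_succ_self _))
          have h2 : (a.val : ℝ) ≤ act π i + 1 := by exact_mod_cast h1
          linarith
        · rw [potential_update_of_par_true hk hN hπ hlast hiN habove hpar hmin]; linarith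
  · have hlast : (fun a : ℕ => (harmonic (k - 1 - a) : ℝ)) (k - 1) = 0 := by simp
    have hlog : Real.log k ≤ harmonic (k - 1) := by
      have := log_add_one_le_harmonic (k - 1)
      rwa [Nat.sub_add_cancel (by omega : 1 ≤ k)] at this
    have hlog0 : 0 ≤ Real.log k := Real.log_nonneg (by linarith)
    refine le_trans (ENNReal.ofReal_le_ofReal ?_) (MDP.ofReal_le_randomExpectedIterations _ idx _
      (fun π => Stale k N (act π))
      (fun π => potential N (fun a : ℕ => (harmonic (k - 1 - a) : ℝ)) (act π))
      ((harmonic (k - 1 - 0) : ℝ) / 2) hstale hinv ?_ fun π _ hs =>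
        potential_le_of_IS_eq_empty hk hN hlast (hlog0.trans hlog) π hs)
    · rw [hstart, potential_zero]
      exact hsize _ _ hlog0 (by simp only [Nat.sub_zero]; linarith)
    · intro π hπ h
      obtain ⟨i, hi, habove⟩ := exists_simpleState_eq hidx h
      have hne := (MDP.H n k).IA_nonempty π ((MDP.H n k).simpleState_mem idx π h)
      rw [hi] at hne ⊢
      have hcard : (((MDP.H n k).IA π (s i)).card : ℝ) ≠ 0 := by
        exact_mod_cast (Finset.card_pos.2 hne).ne'
      have hconst : ∀ f : Fin k → ℝ, ∀ c : ℝ, (∀ a ∈ (MDP.H n k).IA π (s i), f a = c) →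
          (((MDP.H n k).IA π (s i)).card : ℝ)⁻¹ * ∑ a ∈ (MDP.H n k).IA π (s i), f a = c := by
        intro f c hf
        rw [Finset.sum_congr rfl hf, Finset.sum_const, nsmul_eq_mul, inv_mul_cancel_left₀ hcard]
      rcases le_or_gt N i with hiN | hiN
      · rw [hconst _ _ fun a _ => potential_update_of_le hiN a]; linarith
      · cases hpar : par (act π) i
        · have hmem := mem_IA_of_par_false hN π hiN hpar
          have hIA : (MDP.H n k).IA π (s i) =
              Finset.univ.filter fun a : Fin k => act π i < a.val := by
            ext a; simp [hmem]
          have hb : act π i < k := act_val π i ▸ (π (s i)).2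
          rw [Finset.sum_congr rfl fun a ha =>
            potential_update_of_par_false hk hN hiN habove hpar ((hmem a).1 ha),
            Finset.sum_add_distrib, Finset.sum_sub_distrib, mul_add, mul_sub,
            hconst _ _ fun _ _ => rfl, hconst _ _ fun _ _ => rfl]
          rw [hIA, card_filter_lt hb] at hcard ⊢
          rw [sum_harmonic_filter hb, mul_sub, inv_mul_cancel_left₀ hcard, inv_mul_cancel₀ hcard]
          linarith
        · rw [hconst _ _ fun a ha =>
            potential_update_of_par_true hk hN hπ hlast hiN habove hpar ha]
          linarith
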